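/- **Setting.** Let $D\subseteq\mathbb R^n$ be nonempty, open and convex, and let $f:D\to\mathbb R$ be convex and three times continuously differentiable. Write $\|u\|_x:=(u^T\nabla^2 f(x)u)^{1/2}$ for $x\in D$. Suppose that $f$ is a $\nu$-self-concordant barrier, $\nu>0$: for all $x\in D$ and $v\in\mathbb R^n$, the function $\varphi(\tau)=f(x+\tau v)$ satisfies $|\varphi'''(\tau)|\le 2\varphi''(\tau)^{3/2}$ whenever $x+\tau v\in D$, and $2\nabla f(x)^Tu-\|u\|_x^2\le\nu$ for all $x\in D$, $u\in\mathbb R^n$. Let $\Omega=\overline{D}$, let $g:\mathbb R^n\to\mathbb R\cup\{+\infty\}$ be proper, lower semicontinuous and convex, and put $\operatorname{dom}F=D\cap\{g<+\infty\}$. Let $\mathbf x^*$ be a solution of $\min_{x\in\Omega}g(x)$. For $t>0$ let $\mathbf x^*_t$ denote a solution (assumed to exist wherever it is mentioned) of $$\min_{x\in\operatorname{dom}F}\ F(x;t):=f(x)+t^{-1}g(x).$$ For $c\in D$ let $\widehat F(x;t,c):=f(c)+\nabla f(c)^T(x-c)+\tfrac12(x-c)^T\nabla^2f(c)(x-c)+t^{-1}g(x)$.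 A point $y\in\operatorname{dom}F$ is called a $\delta$-solution of $\min_{x\in\operatorname{dom}F}\widehat F(x;t,c)$ if $\widehat F(y;t,c)-\inf_{x\in\operatorname{dom}F}\widehat F(x;t,c)\le\delta^2/2$. **Algorithm.** Let $\omega(\tau)=\tau-\ln(1+\tau)$, $C(\beta)=\frac{\sqrt\beta-2.581\beta}{2.581+\sqrt\beta}$, $\sigma_\beta=\frac{C(\beta)}{(1+C(\beta))\sqrt\nu}$. Input: $t_0>0$, $\beta\in(0,0.15]$, $\kappa\in(0,1)$, $\mathbf x^0\in\operatorname{dom}F$, and $\gamma_0>0$ with $F(\mathbf x^0;t_0)-\inf_{\operatorname{dom} F} F(\cdot;t_0)\le\gamma_0$. *Phase I.* Start from $\mathbf x^0_{t_0}=\mathbf x^0$. For $j=0,1,\dots$ compute a $(\kappa\beta)$-solution $\mathbf s^j$ of $\min_{\operatorname{dom} F}\widehat F(\cdot;t_0,\mathbf x^j_{t_0})$ and set $\mathbf d^j=\mathbf s^j-\mathbf x^j_{t_0}$, $\zeta_j=\|\mathbf d^j\|_{\mathbf x^j_{t_0}}$, $\Gamma_j=\omega(\beta)+\sum_{l\le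 j}\omega((1-\kappa)\zeta_l)$. If $\Gamma_j\ge\gamma_0$, stop with $\mathbf x_{t_0}:=\mathbf x^j_{t_0}$; otherwise set $\mathbf x^{j+1}_{t_0}=\mathbf x^j_{t_0}+\frac{1-\kappa}{1+(1-\kappa)\zeta_j}\mathbf d^j$. *Phase II.* For $k=1,2,\dots,K$ set $t_k=(1\pm\sigma_\beta)t_{k-1}$ (either sign; all $t_k$ are required to be positive), and let $\mathbf x_{t_k}$ be a $\delta_k$-solution of $\min_{\operatorname{dom} F}\widehat F(\cdot;t_k,\mathbf x_{t_{k-1}})$, where $0\le\delta_k\le0.075\beta$. **Lemma.** 1. For every $t>0$, $\mathbf x^*_t\in\operatorname{int}(\Omega)$ (strict feasibility) and $$0\le g(\mathbf x^*_t)-g(\mathbf x^*)\le t\nu .$$ 2. Let $\mathbf x_{t_k}$ be generated by the algorithm. For every $0\le k\le K$, $$g(\mathbf x_{t_k})-g(\mathbf x^*)\ge0\quad\text{and}\quad g(\mathbf x_{t_k})-g(\mathbf x^*_{t_k})\ge-\nu t_k .$$ For $1\le k\le K$ put $\lambda_{t_k}=\|\mathbf x_{t_{k-1}}-\mathbf x^*_{t_k}\|_{\mathbf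 x^*_{t_k}}$ and $\lambda^+_{t_k}=\|\mathbf x_{t_k}-\mathbf x^*_{t_k}\|_{\mathbf x^*_{t_k}}$. If $\lambda_{t_k}<1$, then $$g(\mathbf x_{t_k})-g(\mathbf x^*_{t_k})\le t_k\left(\sqrt\nu\,\frac{\lambda^+_{t_k}}{1-\lambda_{t_k}}+\frac{\lambda_{t_k}}{(1-\lambda_{t_k})^2}\left(\lambda^+_{t_k}+\lambda_{t_k}+\delta_k\right)+\frac{\delta_k^2}{2}\right)$$ and consequently $$0\le g(\mathbf x_{t_k})-g(\mathbf x^*)\le t_k\,\psi(\nu,\lambda_{t_k},\lambda^+_{t_k},\delta_k),$$ where $$\psi(\nu,\lambda,\lambda^+,\delta):=\nu+\sqrt\nu\,\frac{\lambda^+}{1-\lambda}+\frac{\lambda}{(1-\lambda)^2}\left(\lambda^++\lambda+\delta\right)+\frac{\delta^2}{2}.$$ -/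

import Mathlib

namespace ProxPath

noncomputable section

/-- The quadratic form `uᵀ ∇²f(x) u`. -/
def hessForm {n : ℕ} (f : EuclideanSpace ℝ (Fin n) → ℝ) (x u : EuclideanSpace ℝ (Fin n)) : ℝ :=
  fderiv ℝ (fderiv ℝ f) x u u

/-- The local norm `‖u‖_x = (uᵀ ∇²f(x) u)^{1/2}`. -/
def localNorm {n : ℕ} (f : EuclideanSpace ℝ (Fin n) → ℝ) (x u : EuclideanSpace ℝ (Fin n)) : ℝ :=
  Real.sqrt (hessForm f x u)

/-- `f`, with `dom f = D`, is a standard self-concordant function: a convex function of class `C³`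
on a nonempty open convex set `D`, each of whose restrictions `φ(τ) = f(x + τ v)` to a line
satisfies `|φ'''| ≤ 2 (φ'')^{3/2}`. (A function with values in `ℝ ∪ {+∞}` is represented by its
domain `D` and its values on `D`; no value outside `D` is ever used.) -/
structure IsSelfConcordant {n : ℕ} (D : Set (EuclideanSpace ℝ (Fin n)))
    (f : EuclideanSpace ℝ (Fin n) → ℝ) : Prop where
  nonempty : D.Nonempty
  isOpen : IsOpen D
  convexOn : ConvexOn ℝ D f
  contDiffOn : ContDiffOn ℝ 3 f D
  third_le : ∀ x ∈ D, ∀ (v : EuclideanSpace ℝ (Fin n)) (τ : ℝ), x + τ • v ∈ D →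
    |iteratedDeriv 3 (fun r : ℝ => f (x + r • v)) τ|
      ≤ 2 * (iteratedDeriv 2 (fun r : ℝ => f (x + r • v)) τ) ^ (3 / 2 : ℝ)

/-- `f`, with `dom f = D`, is a `ν`-self-concordant barrier (for the closure of `D`):
`sup_u {2 ∇f(x)ᵀu - ‖u‖_x²} ≤ ν` at every `x ∈ D`. -/
structure IsSelfConcordantBarrier {n : ℕ} (D : Set (EuclideanSpace ℝ (Fin n)))
    (f : EuclideanSpace ℝ (Fin n) → ℝ) (ν : ℝ) : Prop where
  selfConcordant : IsSelfConcordant D f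
  pos : 0 < ν
  barrier_le : ∀ x ∈ D, ∀ u : EuclideanSpace ℝ (Fin n),
    2 * fderiv ℝ f x u - hessForm f x u ≤ ν

/-- `g : ℝⁿ → ℝ ∪ {+∞}` is proper, lower semicontinuous and convex (its epigraph is convex). -/
structure IsProperLscConvex {n : ℕ} (g : EuclideanSpace ℝ (Fin n) → EReal) : Prop where
  ne_bot : ∀ x, g x ≠ ⊥
  exists_ne_top : ∃ x, g x ≠ ⊤
  lsc : LowerSemicontinuous g
  convex_epigraph : Convex ℝ {p : EuclideanSpace ℝ (Fin n) × ℝ | g p.1 ≤ (p.2 : EReal)}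

/-- `dom F = dom f ∩ dom g`, where `dom f = D` and `dom g = {g < +∞}`. -/
def domF {n : ℕ} (D : Set (EuclideanSpace ℝ (Fin n)))
    (g : EuclideanSpace ℝ (Fin n) → EReal) : Set (EuclideanSpace ℝ (Fin n)) :=
  D ∩ {x | g x < ⊤}

/-- The penalized objective `F(x; t) = f(x) + t⁻¹ g(x)`, to be used on `dom F` only. -/
def penalized {n : ℕ} (f : EuclideanSpace ℝ (Fin n) → ℝ) (g : EuclideanSpace ℝ (Fin n) → EReal)
    (t : ℝ) (x : EuclideanSpace ℝ (Fin n)) : ℝ :=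
  f x + t⁻¹ * (g x).toReal

/-- `y` solves the penalized problem `min_x F(x; t)`. -/
def IsPenalizedSolution {n : ℕ} (D : Set (EuclideanSpace ℝ (Fin n)))
    (f : EuclideanSpace ℝ (Fin n) → ℝ) (g : EuclideanSpace ℝ (Fin n) → EReal)
    (t : ℝ) (y : EuclideanSpace ℝ (Fin n)) : Prop :=
  y ∈ domF D g ∧ IsMinOn (penalized f g t) (domF D g) y

/-- `y` solves the constrained problem `min_{x ∈ Ω} g(x)`. -/
def IsConstrainedSolution {n : ℕ} (Ω : Set (EuclideanSpace ℝ (Fin n)))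
    (g : EuclideanSpace ℝ (Fin n) → EReal) (y : EuclideanSpace ℝ (Fin n)) : Prop :=
  y ∈ Ω ∧ IsMinOn g Ω y

/-- The quadratic model `Q(x; c) = f(c) + ∇f(c)ᵀ(x - c) + ½ (x - c)ᵀ ∇²f(c) (x - c)`. -/
def quadModel {n : ℕ} (f : EuclideanSpace ℝ (Fin n) → ℝ) (c x : EuclideanSpace ℝ (Fin n)) : ℝ :=
  f c + fderiv ℝ f c (x - c) + (1 / 2) * hessForm f c (x - c)

/-- The composite model `F̂(x; t, c) = Q(x; c) + t⁻¹ g(x)`, to be used on `dom F` only. -/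
def compositeModel {n : ℕ} (f : EuclideanSpace ℝ (Fin n) → ℝ)
    (g : EuclideanSpace ℝ (Fin n) → EReal) (t : ℝ) (c x : EuclideanSpace ℝ (Fin n)) : ℝ :=
  quadModel f c x + t⁻¹ * (g x).toReal

/-- `y` is a `δ`-solution of the subproblem `min_{x ∈ dom F} F̂(x; t, c)`: it lies in `dom F` and its
model value exceeds the optimal one by at most `δ²/2`. The optimal value is taken as an infimum, so
that no exact minimizer has to exist; see `isInexactSolution_iff` for the case where there is one. -/
def IsInexactSolution {n : ℕ} (D : Set (EuclideanSpace ℝ (Fin n)))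
    (f : EuclideanSpace ℝ (Fin n) → ℝ) (g : EuclideanSpace ℝ (Fin n) → EReal)
    (t δ : ℝ) (c y : EuclideanSpace ℝ (Fin n)) : Prop :=
  y ∈ domF D g ∧
    ∀ z ∈ domF D g, compositeModel f g t c y - compositeModel f g t c z ≤ δ ^ 2 / 2

/-- If the subproblem has an exact solution `xbar`, then `y ∈ dom F` is a `δ`-solution exactly when
`F̂(y; t, c) - F̂(xbar; t, c) ≤ δ²/2`. -/
theorem isInexactSolution_iff {n : ℕ} {D : Set (EuclideanSpace ℝ (Fin n))}
    {f : EuclideanSpace ℝ (Fin n) → ℝ} {g : EuclideanSpace ℝ (Fin n) → EReal}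
    {t δ : ℝ} {c y xbar : EuclideanSpace ℝ (Fin n)} (hmem : xbar ∈ domF D g)
    (hmin : IsMinOn (compositeModel f g t c) (domF D g) xbar) :
    IsInexactSolution D f g t δ c y ↔
      y ∈ domF D g ∧ compositeModel f g t c y - compositeModel f g t c xbar ≤ δ ^ 2 / 2 :=
  ⟨fun h => ⟨h.1, h.2 xbar hmem⟩, fun h => ⟨h.1, fun z hz => by
    have h1 : compositeModel f g t c xbar ≤ compositeModel f g t c z := hmin hz
    linarith [h.2]⟩⟩

/-- `ω(τ) = τ - ln(1 + τ)`. -/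
def omega (τ : ℝ) : ℝ := τ - Real.log (1 + τ)

/-- `C(β) = (√β - 2.581 β) / (2.581 + √β)`. -/
def cBeta (β : ℝ) : ℝ := (Real.sqrt β - 2.581 * β) / (2.581 + Real.sqrt β)

/-- `σ_β = C(β) / ((1 + C(β)) √ν)`. -/
def sigmaBeta (β ν : ℝ) : ℝ := cBeta β / ((1 + cBeta β) * Real.sqrt ν)

/-- A run of the inexact path-following proximal-Newton algorithm, carried through Phase I and
through `K` iterations of Phase II. -/
structure PathFollowingRun {n : ℕ} (D : Set (EuclideanSpace ℝ (Fin n)))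
    (f : EuclideanSpace ℝ (Fin n) → ℝ) (g : EuclideanSpace ℝ (Fin n) → EReal) (ν : ℝ) where
  /-- number of Phase II iterations -/
  K : ℕ
  /-- penalty parameters `t₀, …, t_K` -/
  t : ℕ → ℝ
  /-- Phase II points: `x k` is `x_{t_k}` -/
  x : ℕ → EuclideanSpace ℝ (Fin n)
  /-- accuracies: `δ k` is the accuracy with which `x k` is computed, `1 ≤ k ≤ K` -/
  δ : ℕ → ℝ
  β : ℝ
  κ : ℝ
  γ₀ : ℝ
  /-- index at which Phase I stops -/
  J : ℕ
  /-- Phase I points: `z j` is `x^j_{t₀}` -/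
  z : ℕ → EuclideanSpace ℝ (Fin n)
  /-- Phase I trial points -/
  s : ℕ → EuclideanSpace ℝ (Fin n)
  /- input -/
  t_pos : ∀ k ≤ K, 0 < t k
  β_pos : 0 < β
  β_le : β ≤ 0.15
  κ_pos : 0 < κ
  κ_lt_one : κ < 1
  z_zero_mem : z 0 ∈ domF D g
  γ₀_pos : 0 < γ₀
  /-- `γ₀` bounds `F(x⁰; t₀) - min F(·; t₀)` from above -/
  gap_le : ∀ y ∈ domF D g, penalized f g (t 0) (z 0) - penalized f g (t 0) y ≤ γ₀
  /- Phase I: the direction is `d^j = s^j - x^j`, with `ζ_j = ‖d^j‖_{x^j}` -/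
  trial : ∀ j ≤ J, IsInexactSolution D f g (t 0) (κ * β) (z j) (s j)
  /-- `Γ_j < γ₀` before the last Phase I iteration -/
  continue_cond : ∀ j < J,
    omega β + ∑ l ∈ Finset.range (j + 1), omega ((1 - κ) * localNorm f (z l) (s l - z l)) < γ₀
  /-- `Γ_J ≥ γ₀` at the last Phase I iteration -/
  stop_cond :
    γ₀ ≤ omega β + ∑ l ∈ Finset.range (J + 1), omega ((1 - κ) * localNorm f (z l) (s l - z l))
  /-- damped step with `α_j = (1 - κ) / (1 + (1 - κ) ζ_j)` -/
  damped_step : ∀ j < J,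
    z (j + 1) = z j
      + ((1 - κ) / (1 + (1 - κ) * localNorm f (z j) (s j - z j))) • (s j - z j)
  /- Phase II -/
  x_zero : x 0 = z J
  t_succ : ∀ k < K, t (k + 1) = (1 + sigmaBeta β ν) * t k ∨ t (k + 1) = (1 - sigmaBeta β ν) * t k
  δ_nonneg : ∀ k < K, 0 ≤ δ (k + 1)
  δ_le : ∀ k < K, δ (k + 1) ≤ 0.075 * β
  x_succ : ∀ k < K, IsInexactSolution D f g (t (k + 1)) (δ (k + 1)) (x k) (x (k + 1))

/-- `√ν λ⁺/(1 - λ) + λ/(1 - λ)² (λ⁺ + λ + δ) + δ²/2`. -/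
def gapBound (ν lam lamPlus δ : ℝ) : ℝ :=
  Real.sqrt ν * (lamPlus / (1 - lam)) + lam / (1 - lam) ^ 2 * (lamPlus + lam + δ) + δ ^ 2 / 2

/-- `ψ(ν, λ, λ⁺, δ) = ν + √ν λ⁺/(1 - λ) + λ/(1 - λ)² (λ⁺ + λ + δ) + δ²/2`. -/
def psi (ν lam lamPlus δ : ℝ) : ℝ :=
  ν + Real.sqrt ν * (lamPlus / (1 - lam)) + lam / (1 - lam) ^ 2 * (lamPlus + lam + δ) + δ ^ 2 / 2

end

end ProxPath

/-!
Restricting a `ν`-self-concordant barrier to a segment gives the Riccati inequality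
`(φ')² ≤ ν φ''`, whose solutions blow up in finite time unless `∇f(x)ᵀ(y - x) ≤ ν` for every `y` in
the closure of `D`. First-order optimality of `x*_t` bounds `g(x*_t) - g(y)` by
`t ∇f(x*_t)ᵀ(y - x*_t)`, hence by `tν`.

For an inexact step, the model at the old iterate `c` is compared at the new iterate and at `x*_t`.
Since `|D³f(x)[h, v, v]| ≤ 2 ‖h‖_x ‖v‖_x²`, the local norm at `c` exceeds the one at `x*_t` by at
most the factor `1 / (1 - λ)`, where `λ = ‖c - x*_t‖_{x*_t}`. The gradient of the model is then
controlled by `|∇f(c)ᵀu| ≤ √ν ‖u‖_c` and its curvature by Cauchy–Schwarz. Self-concordance gives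
the bound on the third differential only for `h = v`; the mixed values are recovered, on the plane
of `h` and `v`, from an interpolation formula of M. Riesz.
-/

namespace ProxPath

open Filter Topology

section PlaneCubic

variable {p : ℝ → ℝ → ℝ} {a b c d x y r : ℝ}

-- M. Riesz interpolation for cubics: with `(x, y) = (cos ψ, sin ψ)` and `r = √3`, the left-hand
-- side is the polarization of `p` at `(cos 3ψ, sin 3ψ), (1, 0), (1, 0)`, and the nodes are the unit
-- vectors at the angles `ψ` and `ψ ± 2π/3`.
theorem cubic_polarization_eq_interpolation
    (hp : ∀ x y, p x y = a * x ^ 3 + 3 * b * x ^ 2 * y + 3 * c * x * y ^ 2 + d * y ^ 3)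
    (hr : r ^ 2 = 3) (hxy : x ^ 2 + y ^ 2 = 1) :
    a * (4 * x ^ 3 - 3 * x) + b * (3 * y - 4 * y ^ 3) =
      1 / 9 * (3 * x ^ 2 - y ^ 2) ^ 2 * p x y +
      4 / 9 * (y * (y + r * x)) ^ 2 * p (-x / 2 - r * y / 2) (-y / 2 + r * x / 2) +
      4 / 9 * (y * (y - r * x)) ^ 2 * p (-x / 2 + r * y / 2) (-y / 2 - r * x / 2) := by
  have h4 : r ^ 4 = 9 := by rw [show r ^ 4 = (r ^ 2) ^ 2 by ring, hr]; norm_num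
  have hx : 4 * x ^ 3 - 3 * x = (4 * x ^ 3 - 3 * x * (x ^ 2 + y ^ 2)) * (x ^ 2 + y ^ 2) ^ 2 := by
    rw [hxy]; ring
  have hy : 3 * y - 4 * y ^ 3 = (3 * y * (x ^ 2 + y ^ 2) - 4 * y ^ 3) * (x ^ 2 + y ^ 2) ^ 2 := by
    rw [hxy]; ring
  simp only [hx, hy, hp]
  ring_nf
  simp only [hr, h4]
  ring

theorem interpolation_weights_sum (hr : r ^ 2 = 3) (hxy : x ^ 2 + y ^ 2 = 1) :
    1 / 9 * (3 * x ^ 2 - y ^ 2) ^ 2 + 4 / 9 * (y * (y + r * x)) ^ 2 +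
      4 / 9 * (y * (y - r * x)) ^ 2 = 1 := by
  linear_combination (8 / 9 * y ^ 2 * x ^ 2) * hr + (x ^ 2 + y ^ 2 + 1) * hxy

theorem abs_cubic_polarization_le {M : ℝ}
    (hp : ∀ x y, p x y = a * x ^ 3 + 3 * b * x ^ 2 * y + 3 * c * x * y ^ 2 + d * y ^ 3)
    (hM : ∀ x y : ℝ, x ^ 2 + y ^ 2 = 1 → |p x y| ≤ M) (θ : ℝ) :
    |a * Real.cos θ + b * Real.sin θ| ≤ M := by
  obtain ⟨ψ, rfl⟩ : ∃ ψ, θ = 3 * ψ := ⟨θ / 3, by ring⟩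
  have hr : √3 ^ 2 = (3 : ℝ) := Real.sq_sqrt zero_le_three
  have hψ := Real.cos_sq_add_sin_sq ψ
  rw [Real.cos_three_mul, Real.sin_three_mul, cubic_polarization_eq_interpolation hp hr hψ]
  set u := Real.cos ψ
  set v := Real.sin ψ
  have h₀ := hM u v hψ
  have h₁ := hM (-u / 2 - √3 * v / 2) (-v / 2 + √3 * u / 2)
    (by linear_combination ((u ^ 2 + v ^ 2) / 4) * hr + hψ)
  have h₂ := hM (-u / 2 + √3 * v / 2) (-v / 2 - √3 * u / 2)
    (by linear_combination ((u ^ 2 + v ^ 2) / 4) * hr + hψ)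
  have hweight : ∀ {w z : ℝ}, 0 ≤ w → |z| ≤ M → |w * z| ≤ w * M := fun hw hz => by
    rw [abs_mul, abs_of_nonneg hw]
    gcongr
  calc _ ≤ 1 / 9 * (3 * u ^ 2 - v ^ 2) ^ 2 * M + 4 / 9 * (v * (v + √3 * u)) ^ 2 * M +
          4 / 9 * (v * (v - √3 * u)) ^ 2 * M :=
        (abs_add_three _ _ _).trans <| add_le_add_three (hweight (by positivity) h₀)
          (hweight (by positivity) h₁) (hweight (by positivity) h₂)
    _ = M := by rw [← add_mul, ← add_mul, interpolation_weights_sum hr hψ, one_mul]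

end PlaneCubic

section Trilinear

variable {E : Type*} [AddCommGroup E] [Module ℝ E] {T : E →ₗ[ℝ] E →ₗ[ℝ] E →ₗ[ℝ] ℝ} {M : ℝ}

theorem abs_trilinear_combination_le (hl : ∀ a b c, T a b c = T b a c)
    (hr : ∀ a b c, T a b c = T a c b) {v e : E}
    (hM : ∀ x y : ℝ, x ^ 2 + y ^ 2 = 1 →
      |T (x • v + y • e) (x • v + y • e) (x • v + y • e)| ≤ M) (θ : ℝ) :
    |T (Real.cos θ • v + Real.sin θ • e) v v| ≤ M := by
  have hcubic : ∀ x y : ℝ, T (x • v + y • e) (x • v + y • e) (x • v + y • e) =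
      T v v v * x ^ 3 + 3 * T e v v * x ^ 2 * y + 3 * T e e v * x * y ^ 2 + T e e e * y ^ 3 := by
    intro x y
    simp only [map_add, map_smul, LinearMap.add_apply, LinearMap.smul_apply, smul_eq_mul,
      hl v e, hr v v e, hr e v e]
    ring
  have := abs_cubic_polarization_le hcubic hM θ
  simpa only [map_add, map_smul, LinearMap.add_apply, LinearMap.smul_apply, smul_eq_mul,
    mul_comm (T _ _ _)] using this

variable {B : LinearMap.BilinForm ℝ E}

theorem abs_trilinear_le_of_lt_one (hl : ∀ a b c, T a b c = T b a c)
    (hr : ∀ a b c, T a b c = T a c b) (hsymm : B.IsSymm) (hpos : ∀ u, 0 ≤ B u u)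
    (hM : ∀ u, B u u ≤ 1 → |T u u u| ≤ M) {h v : E} (hh : B h h < 1) (hv : B v v < 1) :
    |T h v v| ≤ M := by
  have hcs : B h v ^ 2 ≤ B h h * B v v :=
    B.apply_sq_le_of_symm hpos (LinearMap.BilinForm.isSymm_iff.1 hsymm) h v
  set a := B h v with ha
  have ha1 : 0 < 1 - a ^ 2 := by nlinarith [hpos h, hpos v]
  set s := √(1 - a ^ 2) with hs
  have hs0 : 0 < s := Real.sqrt_pos.2 ha1
  have hs2 : s ^ 2 = 1 - a ^ 2 := Real.sq_sqrt ha1.le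
  -- As `B v v, B h h < 1`, the vectors `v` and `h` are projections of unit vectors with inner
  -- product `a` in an orthogonal extension of `E`; there `e` is a unit vector orthogonal to `v`.
  set e := s⁻¹ • (h - a • v) with he
  have hdecomp : h = Real.cos (Real.arccos a) • v + Real.sin (Real.arccos a) • e := by
    rw [Real.cos_arccos (by nlinarith) (by nlinarith), Real.sin_arccos, ← hs, he,
      smul_inv_smul₀ hs0.ne', add_sub_cancel]
  rw [hdecomp]
  refine abs_trilinear_combination_le hl hr (fun x y hxy => hM _ ?_) _
  have hcomb : x • v + y • e = (x - a * (y / s)) • v + (y / s) • h := by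
    rw [he]; module
  have hB : B (x • v + y • e) (x • v + y • e) = (x - a * (y / s)) ^ 2 * B v v +
      2 * a * (x - a * (y / s)) * (y / s) + (y / s) ^ 2 * B h h := by
    simp only [hcomb, map_add, map_smul, LinearMap.add_apply, LinearMap.smul_apply, smul_eq_mul,
      hsymm.eq v h, ← ha]
    ring
  calc B (x • v + y • e) (x • v + y • e)
      ≤ (x - a * (y / s)) ^ 2 * 1 + 2 * a * (x - a * (y / s)) * (y / s) + (y / s) ^ 2 * 1 := by
        rw [hB]; gcongr
    _ = x ^ 2 + (y / s) ^ 2 * (1 - a ^ 2) := by ring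
    _ = 1 := by rw [← hs2, ← mul_pow, div_mul_cancel₀ _ hs0.ne', hxy]

theorem abs_trilinear_le (hl : ∀ a b c, T a b c = T b a c)
    (hr : ∀ a b c, T a b c = T a c b) (hsymm : B.IsSymm) (hpos : ∀ u, 0 ≤ B u u) (hM : 0 ≤ M)
    (hT : ∀ u, |T u u u| ≤ M * √(B u u) ^ 3) (h v : E) :
    |T h v v| ≤ M * √(B h h) * B v v := by
  have hball : ∀ u, B u u ≤ 1 → |T u u u| ≤ M := fun u hu =>
    (hT u).trans (mul_le_of_le_one_right hM (pow_le_one₀ (Real.sqrt_nonneg _)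
      (Real.sqrt_le_one.2 hu)))
  have hscale : ∀ p q : ℝ, √(B h h) < p → √(B v v) < q → |T h v v| ≤ M * p * q ^ 2 := by
    intro p q hp hq
    have hp0 := (Real.sqrt_nonneg _).trans_lt hp
    have hq0 := (Real.sqrt_nonneg _).trans_lt hq
    have hunit : ∀ {u : E} {w : ℝ}, √(B u u) < w → B (w⁻¹ • u) (w⁻¹ • u) < 1 := by
      intro u w hw
      have hw0 := (Real.sqrt_nonneg _).trans_lt hw
      rw [Real.sqrt_lt' hw0] at hw
      simp only [map_smul, LinearMap.smul_apply, smul_eq_mul]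
      rwa [← mul_assoc, ← mul_inv, ← sq, inv_mul_lt_one₀ (by positivity)]
    have := abs_trilinear_le_of_lt_one hl hr hsymm hpos hball (hunit hp) (hunit hq)
    simp only [map_smul, LinearMap.smul_apply, smul_eq_mul, abs_mul, abs_inv, abs_of_pos hp0,
      abs_of_pos hq0] at this
    field_simp at this
    linarith
  have hlim : Tendsto (fun ε => M * (√(B h h) + ε) * (√(B v v) + ε) ^ 2) (𝓝[>] 0)
      (𝓝 (M * √(B h h) * B v v)) := by
    have hc : Continuous fun ε => M * (√(B h h) + ε) * (√(B v v) + ε) ^ 2 := by fun_prop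
    simpa [Real.sq_sqrt (hpos v)] using (hc.tendsto 0).mono_left nhdsWithin_le_nhds
  refine ge_of_tendsto hlim (eventually_mem_nhdsWithin.mono fun ε hε => ?_)
  exact hscale _ _ (lt_add_of_pos_right _ hε) (lt_add_of_pos_right _ hε)

end Trilinear

section ContDiff

variable {E F : Type*} [NormedAddCommGroup E] [NormedSpace ℝ E]
  [NormedAddCommGroup F] [NormedSpace ℝ F] {f : E → ℝ} {x v : E} {τ : ℝ}

/-- The Hessian `∇²f(x)` as a bilinear form, on any normed space: `hess f x u u` is
`hessForm f x u` when `E` is a Euclidean space. -/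
noncomputable def hess (f : E → ℝ) (x : E) : E →L[ℝ] E →L[ℝ] ℝ := fderiv ℝ (fderiv ℝ f) x

/-- The local norm `‖u‖_x`, on any normed space. It is a seminorm where `∇²f(x)` is positive
semidefinite; `√` makes it `0` on directions of negative curvature. -/
noncomputable def hessNorm (f : E → ℝ) (x u : E) : ℝ := √(hess f x u u)

theorem hessNorm_nonneg (f : E → ℝ) (x u : E) : 0 ≤ hessNorm f x u := Real.sqrt_nonneg _

theorem contDiffAt_hess (hf : ContDiffAt ℝ 3 f x) : ContDiffAt ℝ 1 (hess f) x :=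
  (hf.fderiv_right (m := 2) (by norm_num)).fderiv_right (by norm_num)

theorem hess_comm (hf : ContDiffAt ℝ 3 f x) (a b : E) : hess f x a b = hess f x b a :=
  hf.isSymmSndFDerivAt (by rw [minSmoothness_of_isRCLikeNormedField]; norm_num) a b

theorem hasDerivAt_comp_line {G : E → F} (hG : DifferentiableAt ℝ G (x + τ • v)) :
    HasDerivAt (fun r : ℝ => G (x + r • v)) (fderiv ℝ G (x + τ • v) v) τ := by
  have hline : HasDerivAt (fun r : ℝ => x + r • v) v τ := by
    simpa using ((hasDerivAt_id τ).smul_const v).const_add x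
  exact hG.hasFDerivAt.comp_hasDerivAt τ hline

theorem hasDerivAt_fderiv_line (hf : ContDiffAt ℝ 3 f (x + τ • v)) (b : E) :
    HasDerivAt (fun r : ℝ => fderiv ℝ f (x + r • v) b) (hess f (x + τ • v) v b) τ := by
  have hdiff : DifferentiableAt ℝ (fderiv ℝ f) (x + τ • v) :=
    (hf.fderiv_right (m := 2) (by norm_num)).differentiableAt (by norm_num)
  simpa [hess] using (hasDerivAt_comp_line hdiff).clm_apply (hasDerivAt_const τ b)

theorem hasDerivAt_hess_line (hf : ContDiffAt ℝ 3 f (x + τ • v)) (b c : E) :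
    HasDerivAt (fun r : ℝ => hess f (x + r • v) b c)
      (fderiv ℝ (hess f) (x + τ • v) v b c) τ := by
  have hdiff := (contDiffAt_hess hf).differentiableAt one_ne_zero
  simpa using ((hasDerivAt_comp_line hdiff).clm_apply (hasDerivAt_const τ b)).clm_apply
    (hasDerivAt_const τ c)

theorem eventually_contDiffAt_line (hf : ContDiffAt ℝ 3 f (x + τ • v)) :
    ∀ᶠ r : ℝ in 𝓝 τ, ContDiffAt ℝ 3 f (x + r • v) := by
  have hline : Continuous fun r : ℝ => x + r • v := by fun_prop
  exact hline.continuousAt.eventually (hf.eventually (by norm_num))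

theorem fderiv_hess_comm_left (hf : ContDiffAt ℝ 3 f x) (a b c : E) :
    fderiv ℝ (hess f) x a b c = fderiv ℝ (hess f) x b a c :=
  congrArg (· c) <|
    (hf.fderiv_right (m := 2) (by norm_num)).isSymmSndFDerivAt (by simp) a b

theorem fderiv_hess_comm_right (hf : ContDiffAt ℝ 3 f x) (a b c : E) :
    fderiv ℝ (hess f) x a b c = fderiv ℝ (hess f) x a c b := by
  obtain ⟨y, hy⟩ : ∃ y, y + (0 : ℝ) • a = x := ⟨x, by simp⟩
  rw [← hy] at hf ⊢
  have hcomm : (fun r : ℝ => hess f (y + r • a) b c) =ᶠ[𝓝 0] fun r => hess f (y + r • a) c b :=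
    (eventually_contDiffAt_line hf).mono fun r hr => hess_comm hr b c
  exact (hasDerivAt_hess_line hf b c).unique
    ((hasDerivAt_hess_line hf c b).congr_of_eventuallyEq hcomm)

theorem iteratedDeriv_two_line (hf : ContDiffAt ℝ 3 f (x + τ • v)) :
    iteratedDeriv 2 (fun r : ℝ => f (x + r • v)) τ = hess f (x + τ • v) v v := by
  have hderiv : deriv (fun r : ℝ => f (x + r • v)) =ᶠ[𝓝 τ] fun r => fderiv ℝ f (x + r • v) v :=
    (eventually_contDiffAt_line hf).mono fun r hr =>
      (hasDerivAt_comp_line (hr.differentiableAt (by norm_num))).deriv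
  rw [iteratedDeriv_succ, iteratedDeriv_one, hderiv.deriv_eq]
  exact (hasDerivAt_fderiv_line hf v).deriv

theorem iteratedDeriv_three_line (hf : ContDiffAt ℝ 3 f (x + τ • v)) :
    iteratedDeriv 3 (fun r : ℝ => f (x + r • v)) τ = fderiv ℝ (hess f) (x + τ • v) v v v := by
  have hderiv : iteratedDeriv 2 (fun r : ℝ => f (x + r • v)) =ᶠ[𝓝 τ]
      fun r => hess f (x + r • v) v v :=
    (eventually_contDiffAt_line hf).mono fun r hr => iteratedDeriv_two_line hr
  rw [iteratedDeriv_succ, hderiv.deriv_eq]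
  exact (hasDerivAt_hess_line hf v v).deriv

end ContDiff

section OneVariable

open Set

-- `(l / (1 - τ l))²` solves `P' = 2 P^(3/2)`; replacing `l` by `m > l` in the denominator makes it
-- a strict supersolution, as the comparison theorem requires.
theorem le_sq_of_deriv_le_two_mul_sqrt_cube {P P' : ℝ → ℝ} {l m : ℝ}
    (hP : ∀ r ∈ Icc (0 : ℝ) 1, HasDerivAt P (P' r) r)
    (hle : ∀ r ∈ Icc (0 : ℝ) 1, P' r ≤ 2 * √(P r) ^ 3) (hl : 0 < l) (h0 : P 0 ≤ l ^ 2)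
    (hlm : l < m) (hm : m < 1) {τ : ℝ} (hτ : τ ∈ Icc (0 : ℝ) 1) :
    P τ ≤ (l / (1 - τ * m)) ^ 2 := by
  have hden : ∀ r ∈ Icc (0 : ℝ) 1, 0 < 1 - r * m := fun r hr => by nlinarith [hr.1, hr.2]
  have hQ : ∀ r ∈ Icc (0 : ℝ) 1, HasDerivAt (fun r => (l / (1 - r * m)) ^ 2)
      (2 * l ^ 2 * m / (1 - r * m) ^ 3) r := by
    intro r hr
    have hlin : HasDerivAt (fun r => 1 - r * m) (-m) r := by
      simpa using ((hasDerivAt_id r).mul_const m).const_sub 1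
    have hne := (hden r hr).ne'
    refine (((hasDerivAt_const r l).div hlin hne).pow 2).congr_deriv ?_
    simp only [Pi.div_apply, Nat.cast_ofNat, Nat.add_one_sub_one, pow_one, zero_mul, mul_neg,
      zero_sub, neg_neg]
    field_simp
  refine image_le_of_deriv_right_lt_deriv_boundary'
    (fun r hr => (hP r hr).continuousAt.continuousWithinAt)
    (fun r hr => (hP r (Ico_subset_Icc_self hr)).hasDerivWithinAt) (by simpa using h0)
    (fun r hr => (hQ r hr).continuousAt.continuousWithinAt)
    (fun r hr => (hQ r (Ico_subset_Icc_self hr)).hasDerivWithinAt)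
    (fun r hr hcontact => ?_) hτ
  have hr' := Ico_subset_Icc_self hr
  have hd := hden r hr'
  calc P' r ≤ 2 * (l / (1 - r * m)) ^ 3 := by
        simpa only [hcontact, Real.sqrt_sq (div_pos hl hd).le] using hle r hr'
    _ = 2 * l ^ 2 * l / (1 - r * m) ^ 3 := by rw [div_pow]; ring
    _ < 2 * l ^ 2 * m / (1 - r * m) ^ 3 := by gcongr

theorem sqrt_le_div_of_deriv_le_two_mul_sqrt_cube {P P' : ℝ → ℝ} {l : ℝ}
    (hP : ∀ r ∈ Icc (0 : ℝ) 1, HasDerivAt P (P' r) r)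
    (hle : ∀ r ∈ Icc (0 : ℝ) 1, P' r ≤ 2 * √(P r) ^ 3) (h0 : √(P 0) ≤ l) (hl : l < 1)
    {τ : ℝ} (hτ : τ ∈ Icc (0 : ℝ) 1) : √(P τ) ≤ l / (1 - τ * l) := by
  obtain ⟨hl0, hPl⟩ := Real.sqrt_le_iff.1 h0
  have hden : 0 < 1 - τ * l := by nlinarith [hτ.1, hτ.2]
  have hlim : Tendsto (fun ε => (l + ε) / (1 - τ * (l + 2 * ε))) (𝓝[>] 0)
      (𝓝 (l / (1 - τ * l))) := by
    have hc : ContinuousAt (fun ε => (l + ε) / (1 - τ * (l + 2 * ε))) 0 :=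
      ContinuousAt.div (by fun_prop) (by fun_prop) (by simpa using hden.ne')
    simpa using hc.tendsto.mono_left nhdsWithin_le_nhds
  refine ge_of_tendsto hlim ?_
  filter_upwards [Ioo_mem_nhdsGT (show (0 : ℝ) < (1 - l) / 2 by linarith)] with ε ⟨hε0, hε⟩
  refine Real.sqrt_le_iff.2 ⟨div_nonneg (by linarith) (by nlinarith [hτ.1, hτ.2]), ?_⟩
  exact le_sq_of_deriv_le_two_mul_sqrt_cube hP hle (by linarith) (by nlinarith) (by linarith)
    (by linarith) hτ

theorem mul_sq_le_of_deriv_le_div_mul {H H' : ℝ → ℝ} {l : ℝ}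
    (hH : ∀ r ∈ Icc (0 : ℝ) 1, HasDerivAt H (H' r) r)
    (hle : ∀ r ∈ Icc (0 : ℝ) 1, H' r ≤ 2 * (l / (1 - r * l)) * H r) (hl : l < 1) :
    H 1 * (1 - l) ^ 2 ≤ H 0 := by
  have hd : ∀ r ∈ Icc (0 : ℝ) 1, HasDerivAt (fun r => H r * (1 - r * l) ^ 2)
      (H' r * (1 - r * l) ^ 2 - 2 * l * (1 - r * l) * H r) r := by
    intro r hr
    have hlin : HasDerivAt (fun r => 1 - r * l) (-l) r := by
      simpa using ((hasDerivAt_id r).mul_const l).const_sub 1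
    refine ((hH r hr).mul (hlin.pow 2)).congr_deriv ?_
    simp only [Pi.pow_apply, Nat.cast_ofNat]
    ring
  have hanti : AntitoneOn (fun r => H r * (1 - r * l) ^ 2) (Icc 0 1) := by
    refine antitoneOn_of_hasDerivWithinAt_nonpos (convex_Icc 0 1)
      (fun r hr => (hd r hr).continuousAt.continuousWithinAt)
      (fun r hr => (hd r (interior_subset hr)).hasDerivWithinAt) (fun r hr => ?_)
    have hr' := interior_subset hr
    have hden : 0 < 1 - r * l := by nlinarith [hr'.1, hr'.2, mul_nonneg hr'.1 (sub_nonneg.2 hl.le)]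
    have := mul_le_mul_of_nonneg_right (hle r hr') (sq_nonneg (1 - r * l))
    have hsimp : 2 * (l / (1 - r * l)) * H r * (1 - r * l) ^ 2 = 2 * l * (1 - r * l) * H r := by
      field_simp [hden.ne']
    linarith
  simpa using hanti (left_mem_Icc.2 zero_le_one) (right_mem_Icc.2 zero_le_one) zero_le_one

-- Otherwise `φ` is a positive solution of `φ' ≥ φ² / ν` and blows up at time `ν / φ 0 < 1`.
theorem le_of_sq_le_mul_deriv {φ φ' : ℝ → ℝ} {ν : ℝ} (hν : 0 ≤ ν)
    (hφ : ∀ r ∈ Ico (0 : ℝ) 1, HasDerivAt φ (φ' r) r)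
    (hle : ∀ r ∈ Ico (0 : ℝ) 1, φ r ^ 2 ≤ ν * φ' r) : φ 0 ≤ ν := by
  have h0 : (0 : ℝ) ∈ Ico (0 : ℝ) 1 := ⟨le_rfl, zero_lt_one⟩
  obtain rfl | hν := hν.eq_or_lt
  · nlinarith [hle 0 h0]
  by_contra! hlt
  have hmono : MonotoneOn φ (Ico 0 1) :=
    monotoneOn_of_hasDerivWithinAt_nonneg (convex_Ico 0 1)
      (fun r hr => (hφ r hr).continuousAt.continuousWithinAt)
      (fun r hr => (hφ r (interior_subset hr)).hasDerivWithinAt)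
      (fun r hr => (mul_nonneg_iff_of_pos_left hν).1
        ((sq_nonneg _).trans (hle r (interior_subset hr))))
  have hpos : ∀ r ∈ Ico (0 : ℝ) 1, 0 < φ r := fun r hr =>
    (hν.trans hlt).trans_le (hmono h0 hr hr.1)
  have hd : ∀ r ∈ Ico (0 : ℝ) 1, HasDerivAt (fun r => ν / φ r + r) (1 - ν * φ' r / φ r ^ 2) r := by
    intro r hr
    refine (((hasDerivAt_const r ν).div (hφ r hr) (hpos r hr).ne').add
      (hasDerivAt_id r)).congr_deriv ?_
    ring
  have hanti : AntitoneOn (fun r => ν / φ r + r) (Ico 0 1) := by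
    refine antitoneOn_of_hasDerivWithinAt_nonpos (convex_Ico 0 1)
      (fun r hr => (hd r hr).continuousAt.continuousWithinAt)
      (fun r hr => (hd r (interior_subset hr)).hasDerivWithinAt) (fun r hr => ?_)
    have hr' := interior_subset hr
    exact sub_nonpos.2 ((one_le_div (pow_pos (hpos r hr') 2)).2 (hle r hr'))
  have hτ : ν / φ 0 ∈ Ico (0 : ℝ) 1 :=
    ⟨div_nonneg hν.le (hν.trans hlt).le, (div_lt_one (hν.trans hlt)).2 hlt⟩
  have hblowup : ν / φ (ν / φ 0) + ν / φ 0 ≤ ν / φ 0 + 0 := hanti h0 hτ hτ.1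
  linarith [div_pos hν (hpos _ hτ)]

end OneVariable

section Barrier

open Set

variable {E : Type*} [NormedAddCommGroup E] [NormedSpace ℝ E]
  {D : Set E} {f : E → ℝ} {ν : ℝ} {x y z c : E}

/-- A standard `ν`-self-concordant barrier on an open convex subset `D` of any normed space, in
terms of the third differential `D³f(x)[v, v, v]` instead of restrictions to lines. -/
structure IsBarrierOn (D : Set E) (f : E → ℝ) (ν : ℝ) : Prop where
  isOpen : IsOpen D
  convex : Convex ℝ D
  contDiffOn : ContDiffOn ℝ 3 f D
  third_le : ∀ x ∈ D, ∀ v, |fderiv ℝ (hess f) x v v v| ≤ 2 * hessNorm f x v ^ 3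
  barrier_le : ∀ x ∈ D, ∀ u, 2 * fderiv ℝ f x u - hess f x u u ≤ ν

/-- The second-order Taylor polynomial of `f` at `c`, evaluated at `x`: it is `quadModel f c x`,
on any normed space. -/
noncomputable def taylorTwo (f : E → ℝ) (c x : E) : ℝ :=
  f c + fderiv ℝ f c (x - c) + 1 / 2 * hess f c (x - c) (x - c)

theorem taylorTwo_sub_taylorTwo (hf : ContDiffAt ℝ 3 f c) (x y : E) :
    taylorTwo f c x - taylorTwo f c y =
      -fderiv ℝ f c (y - x) + hess f c (c - x) (y - x) - 1 / 2 * hess f c (y - x) (y - x) := by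
  have hy : y - c = (y - x) - (c - x) := by abel
  have hx : x - c = -(c - x) := by abel
  rw [taylorTwo, taylorTwo, hy, hx]
  generalize c - x = a, y - x = b
  simp only [map_sub, map_neg, sub_apply, neg_apply, hess_comm hf b a]
  ring

theorem add_smul_sub_mem_of_mem_closure (ho : IsOpen D) (hD : Convex ℝ D) (hx : x ∈ D)
    (hz : z ∈ closure D) {s : ℝ} (hs : s ∈ Ico (0 : ℝ) 1) : x + s • (z - x) ∈ D := by
  have := hD.combo_interior_closure_mem_interior (ho.interior_eq.symm ▸ hx) hz
    (sub_pos.2 hs.2) hs.1 (sub_add_cancel 1 s)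
  rw [ho.interior_eq] at this
  convert this using 1
  module

theorem two_mul_sub_le_of_forall_le (h : ∀ u, 2 * fderiv ℝ f x u - hess f x u u ≤ ν) (u : E)
    (s : ℝ) : 2 * s * fderiv ℝ f x u - s ^ 2 * hess f x u u ≤ ν := by
  have := h (s • u)
  simp only [map_smul, smul_apply, smul_eq_mul] at this
  linarith

theorem hess_nonneg_of_forall_le (h : ∀ u, 2 * fderiv ℝ f x u - hess f x u u ≤ ν) (u : E) :
    0 ≤ hess f x u u := by
  by_contra! hneg
  have hν : 0 ≤ ν := by simpa using h 0
  have hs : √((ν + 1) / -hess f x u u) ^ 2 = (ν + 1) / -hess f x u u :=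
    Real.sq_sqrt (div_nonneg (add_nonneg hν zero_le_one) (neg_pos.2 hneg).le)
  set s := √((ν + 1) / -hess f x u u)
  have hsq : s ^ 2 * -hess f x u u = ν + 1 := by
    rw [hs, div_mul_cancel₀ _ (neg_pos.2 hneg).ne']
  linarith [two_mul_sub_le_of_forall_le h u s, two_mul_sub_le_of_forall_le h u (-s), neg_sq s]

theorem IsSelfConcordantBarrier.isBarrierOn {n : ℕ} {D : Set (EuclideanSpace ℝ (Fin n))}
    {f : EuclideanSpace ℝ (Fin n) → ℝ} (hf : IsSelfConcordantBarrier D f ν) :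
    IsBarrierOn D f ν where
  isOpen := hf.selfConcordant.isOpen
  convex := hf.selfConcordant.convexOn.1
  contDiffOn := hf.selfConcordant.contDiffOn
  barrier_le := hf.barrier_le
  third_le x hx v := by
    have h0 : x + (0 : ℝ) • v = x := by simp
    have hC : ContDiffAt ℝ 3 f (x + (0 : ℝ) • v) := by
      rw [h0]
      exact hf.selfConcordant.contDiffOn.contDiffAt (hf.selfConcordant.isOpen.mem_nhds hx)
    have hpow : hess f x v v ^ (3 / 2 : ℝ) ≤ hessNorm f x v ^ 3 := by
      rw [Real.rpow_div_two_eq_sqrt 3 (hess_nonneg_of_forall_le (hf.barrier_le x hx) v)]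
      exact (Real.rpow_natCast _ 3).le
    have hthird := hf.selfConcordant.third_le x hx v 0 (h0.symm ▸ hx)
    rw [iteratedDeriv_three_line hC, iteratedDeriv_two_line hC, h0] at hthird
    linarith

namespace IsBarrierOn

theorem contDiffAt (hf : IsBarrierOn D f ν) (hx : x ∈ D) : ContDiffAt ℝ 3 f x :=
  hf.contDiffOn.contDiffAt (hf.isOpen.mem_nhds hx)

theorem differentiableAt (hf : IsBarrierOn D f ν) (hx : x ∈ D) : DifferentiableAt ℝ f x :=
  (hf.contDiffAt hx).differentiableAt (by norm_num)

theorem nonneg (hf : IsBarrierOn D f ν) (hx : x ∈ D) : 0 ≤ ν := by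
  simpa using hf.barrier_le x hx 0

theorem hess_nonneg (hf : IsBarrierOn D f ν) (hx : x ∈ D) (u : E) : 0 ≤ hess f x u u :=
  hess_nonneg_of_forall_le (hf.barrier_le x hx) u

theorem hessNorm_sq (hf : IsBarrierOn D f ν) (hx : x ∈ D) (u : E) :
    hessNorm f x u ^ 2 = hess f x u u :=
  Real.sq_sqrt (hf.hess_nonneg hx u)

theorem sq_fderiv_le (hf : IsBarrierOn D f ν) (hx : x ∈ D) (u : E) :
    fderiv ℝ f x u ^ 2 ≤ ν * hess f x u u := by
  have := discrim_le_zero (a := hess f x u u) (b := -(2 * fderiv ℝ f x u)) (c := ν) fun s => by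
    linarith [two_mul_sub_le_of_forall_le (hf.barrier_le x hx) u s]
  rw [discrim] at this
  linarith

theorem abs_fderiv_le (hf : IsBarrierOn D f ν) (hx : x ∈ D) (u : E) :
    |fderiv ℝ f x u| ≤ √ν * hessNorm f x u := by
  rw [hessNorm, ← Real.sqrt_mul (hf.nonneg hx)]
  exact Real.abs_le_sqrt (hf.sq_fderiv_le hx u)

theorem abs_hess_le (hf : IsBarrierOn D f ν) (hx : x ∈ D) (a b : E) :
    |hess f x a b| ≤ hessNorm f x a * hessNorm f x b := by
  rw [hessNorm, hessNorm, ← Real.sqrt_mul (hf.hess_nonneg hx a)]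
  exact Real.abs_le_sqrt <| LinearMap.BilinForm.apply_sq_le_of_symm (hess f x).toBilinForm
    (hf.hess_nonneg hx) (LinearMap.isSymm_def.2 (hess_comm (hf.contDiffAt hx))) a b

theorem abs_fderiv_hess_le (hf : IsBarrierOn D f ν) (hx : x ∈ D) (h v : E) :
    |fderiv ℝ (hess f) x h v v| ≤ 2 * hessNorm f x h * hess f x v v :=
  abs_trilinear_le
    (T := ContinuousLinearMap.toLinearMap₁₂ ∘ₗ (fderiv ℝ (hess f) x : E →ₗ[ℝ] E →L[ℝ] E →L[ℝ] ℝ))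
    (B := (hess f x).toBilinForm) (fderiv_hess_comm_left (hf.contDiffAt hx))
    (fderiv_hess_comm_right (hf.contDiffAt hx)) ⟨hess_comm (hf.contDiffAt hx)⟩
    (hf.hess_nonneg hx) zero_le_two (hf.third_le x hx) h v

theorem hessNorm_mul_le (hf : IsBarrierOn D f ν) (hx : x ∈ D) (hy : y ∈ D)
    (hlt : hessNorm f x (y - x) < 1) (u : E) :
    hessNorm f y u * (1 - hessNorm f x (y - x)) ≤ hessNorm f x u := by
  set v := y - x with hv
  set l := hessNorm f x v
  have hmem : ∀ r ∈ Icc (0 : ℝ) 1, x + r • v ∈ D := fun r hr =>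
    hf.convex.add_smul_sub_mem hx hy hr
  have hspeed : ∀ r ∈ Icc (0 : ℝ) 1, hessNorm f (x + r • v) v ≤ l / (1 - r * l) := fun r hr =>
    sqrt_le_div_of_deriv_le_two_mul_sqrt_cube
      (fun s hs => hasDerivAt_hess_line (hf.contDiffAt (hmem s hs)) v v)
      (fun s hs => (le_abs_self _).trans (hf.third_le _ (hmem s hs) v))
      (by simp only [zero_smul, add_zero]; exact le_rfl) hlt hr
  have hcompare : hess f (x + (1 : ℝ) • v) u u * (1 - l) ^ 2 ≤ hess f (x + (0 : ℝ) • v) u u :=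
    mul_sq_le_of_deriv_le_div_mul
      (fun r hr => hasDerivAt_hess_line (hf.contDiffAt (hmem r hr)) u u)
      (fun r hr => ((le_abs_self _).trans (hf.abs_fderiv_hess_le (hmem r hr) v u)).trans
        (mul_le_mul_of_nonneg_right (mul_le_mul_of_nonneg_left (hspeed r hr) zero_le_two)
          (hf.hess_nonneg (hmem r hr) u))) hlt
  rw [one_smul, zero_smul, add_zero, hv, add_sub_cancel, ← hf.hessNorm_sq hx, ← hf.hessNorm_sq hy,
    ← mul_pow] at hcompare
  exact le_of_sq_le_sq hcompare (hessNorm_nonneg f x u)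

theorem hessNorm_le_div (hf : IsBarrierOn D f ν) (hx : x ∈ D) (hy : y ∈ D)
    (hlt : hessNorm f x (y - x) < 1) (u : E) :
    hessNorm f y u ≤ hessNorm f x u / (1 - hessNorm f x (y - x)) :=
  (le_div_iff₀ (sub_pos.2 hlt)).2 (hf.hessNorm_mul_le hx hy hlt u)

theorem fderiv_sub_le (hf : IsBarrierOn D f ν) (hx : x ∈ D) (hy : y ∈ closure D) :
    fderiv ℝ f x (y - x) ≤ ν := by
  have hmem : ∀ r ∈ Ico (0 : ℝ) 1, x + r • (y - x) ∈ D := fun r hr =>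
    add_smul_sub_mem_of_mem_closure hf.isOpen hf.convex hx hy hr
  simpa using le_of_sq_le_mul_deriv (hf.nonneg hx)
    (fun r hr => hasDerivAt_fderiv_line (hf.contDiffAt (hmem r hr)) (y - x))
    (fun r hr => hf.sq_fderiv_le (hmem r hr) (y - x))

theorem taylorTwo_sub_le (hf : IsBarrierOn D f ν) (hx : x ∈ D) (hc : c ∈ D)
    (hlt : hessNorm f x (c - x) < 1) (y : E) :
    taylorTwo f c x - taylorTwo f c y ≤
      √ν * (hessNorm f x (y - x) / (1 - hessNorm f x (c - x))) +
        hessNorm f x (c - x) / (1 - hessNorm f x (c - x)) ^ 2 * hessNorm f x (y - x) := by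
  set l := hessNorm f x (c - x)
  set m := hessNorm f x (y - x)
  have hm : hessNorm f c (y - x) ≤ m / (1 - l) := hf.hessNorm_le_div hx hc hlt _
  have hl : hessNorm f c (c - x) ≤ l / (1 - l) := hf.hessNorm_le_div hx hc hlt _
  have hgrad : -fderiv ℝ f c (y - x) ≤ √ν * (m / (1 - l)) :=
    (neg_le_abs _).trans ((hf.abs_fderiv_le hc _).trans (by gcongr))
  have hcross : hess f c (c - x) (y - x) ≤ l / (1 - l) ^ 2 * m :=
    calc hess f c (c - x) (y - x) ≤ hessNorm f c (c - x) * hessNorm f c (y - x) :=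
          (le_abs_self _).trans (hf.abs_hess_le hc _ _)
      _ ≤ l / (1 - l) * (m / (1 - l)) :=
          mul_le_mul hl hm (hessNorm_nonneg _ _ _) ((hessNorm_nonneg _ _ _).trans hl)
      _ = l / (1 - l) ^ 2 * m := by rw [div_mul_div_comm, ← sq, div_mul_eq_mul_div]
  rw [taylorTwo_sub_taylorTwo (hf.contDiffAt hc)]
  linarith [hf.hess_nonneg hc (y - x)]

end IsBarrierOn

end Barrier

section Optimality

variable {E : Type*} [NormedAddCommGroup E] [NormedSpace ℝ E]
  {D S : Set E} {f h : E → ℝ} {x z : E} {t : ℝ}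

theorem sub_le_mul_fderiv_of_isMinOn (ho : IsOpen D) (hD : Convex ℝ D) (hh : ConvexOn ℝ S h)
    (hf : DifferentiableAt ℝ f x) (ht : 0 < t) (hx : x ∈ D ∩ S)
    (hmin : IsMinOn (fun y => f y + t⁻¹ * h y) (D ∩ S) x) (hz : z ∈ closure D ∩ S) :
    h x - h z ≤ t * fderiv ℝ f x (z - x) := by
  have hslope : Tendsto (fun s : ℝ => t * (s⁻¹ • (f (x + s • (z - x)) - f x))) (𝓝[>] 0)
      (𝓝 (t * fderiv ℝ f x (z - x))) := by
    have hline : HasDerivAt (fun s : ℝ => f (x + s • (z - x))) (fderiv ℝ f x (z - x)) 0 := by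
      have hf0 : DifferentiableAt ℝ f (x + (0 : ℝ) • (z - x)) := by simpa using hf
      simpa only [zero_smul, add_zero] using hasDerivAt_comp_line hf0
    simpa only [zero_smul, add_zero, zero_add] using hline.tendsto_slope_zero_right.const_mul t
  refine ge_of_tendsto hslope ?_
  filter_upwards [Ioo_mem_nhdsGT (zero_lt_one (α := ℝ))] with s ⟨hs0, hs1⟩
  have hconv : h (x + s • (z - x)) ≤ h x + s * (h z - h x) := by
    have := hh.2 hx.2 hz.2 (sub_nonneg.2 hs1.le) hs0.le (sub_add_cancel 1 s)
    rw [show (1 - s) • x + s • z = x + s • (z - x) by module, smul_eq_mul, smul_eq_mul] at this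
    linarith
  have hmem : x + s • (z - x) ∈ D ∩ S :=
    ⟨add_smul_sub_mem_of_mem_closure ho hD hx.1 hz.1 ⟨hs0.le, hs1⟩,
      hh.1.add_smul_sub_mem hx.2 hz.2 ⟨hs0.le, hs1.le⟩⟩
  have hle : f x + t⁻¹ * h x ≤ f (x + s • (z - x)) + t⁻¹ * h (x + s • (z - x)) := hmin hmem
  rw [smul_eq_mul, ← div_le_iff₀' ht, le_inv_mul_iff₀ hs0]
  have hmul := mul_le_mul_of_nonneg_left hconv (inv_nonneg.2 ht.le)
  rw [div_eq_inv_mul]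
  linarith

end Optimality

section ExtendedReal

variable {E : Type*} {g : E → EReal} {x y : E}

theorem sub_eq_coe_toReal_sub (hbot : ∀ x, g x ≠ ⊥) (hx : g x < ⊤) (hy : g y < ⊤) :
    g x - g y = (((g x).toReal - (g y).toReal : ℝ) : EReal) := by
  rw [EReal.coe_sub, EReal.coe_toReal hx.ne (hbot x), EReal.coe_toReal hy.ne (hbot y)]

theorem convexOn_toReal [AddCommGroup E] [Module ℝ E] (hbot : ∀ x, g x ≠ ⊥)
    (hepi : Convex ℝ {p : E × ℝ | g p.1 ≤ (p.2 : EReal)}) :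
    ConvexOn ℝ {x | g x < ⊤} fun x => (g x).toReal := by
  have hcomb : ∀ ⦃x⦄, g x < ⊤ → ∀ ⦃y⦄, g y < ⊤ → ∀ ⦃a b : ℝ⦄, 0 ≤ a → 0 ≤ b → a + b = 1 →
      g (a • x + b • y) ≤ ((a * (g x).toReal + b * (g y).toReal : ℝ) : EReal) :=
    fun x hx y hy a b ha hb hab => hepi (x := (x, (g x).toReal)) (y := (y, (g y).toReal))
      (EReal.coe_toReal hx.ne (hbot x)).ge (EReal.coe_toReal hy.ne (hbot y)).ge ha hb hab
  refine ⟨fun x hx y hy a b ha hb hab => ?_, fun x hx y hy a b ha hb hab => ?_⟩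
  · exact (hcomb hx hy ha hb hab).trans_lt (EReal.coe_lt_top _)
  · exact EReal.toReal_le_toReal (hcomb hx hy ha hb hab) (hbot _) (EReal.coe_ne_top _)

theorem toReal_le_of_isMinOn {Ω : Set E} (hbot : g x ≠ ⊥) (hmin : IsMinOn g Ω x)
    (hy : y ∈ Ω) (hgy : g y < ⊤) : (g x).toReal ≤ (g y).toReal :=
  EReal.toReal_le_toReal (hmin hy) hbot hgy.ne

end ExtendedReal

section Run

variable {n : ℕ} {D : Set (EuclideanSpace ℝ (Fin n))} {f : EuclideanSpace ℝ (Fin n) → ℝ}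
  {g : EuclideanSpace ℝ (Fin n) → EReal} {ν : ℝ} (r : PathFollowingRun D f g ν)

namespace PathFollowingRun

theorem damping_mem_Icc (j : ℕ) :
    (1 - r.κ) / (1 + (1 - r.κ) * localNorm f (r.z j) (r.s j - r.z j)) ∈ Set.Icc (0 : ℝ) 1 := by
  have hκ : 0 ≤ 1 - r.κ := sub_nonneg.2 r.κ_lt_one.le
  have hnorm : 0 ≤ localNorm f (r.z j) (r.s j - r.z j) := Real.sqrt_nonneg _
  have hden : 1 ≤ 1 + (1 - r.κ) * localNorm f (r.z j) (r.s j - r.z j) :=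
    le_add_of_nonneg_right (mul_nonneg hκ hnorm)
  exact ⟨by positivity, div_le_one_of_le₀ (by linarith [r.κ_pos]) (by linarith)⟩

theorem z_mem (h : Convex ℝ (domF D g)) : ∀ j ≤ r.J, r.z j ∈ domF D g
  | 0, _ => r.z_zero_mem
  | j + 1, hj => by
    rw [r.damped_step j hj]
    exact h.add_smul_sub_mem (z_mem h j (Nat.le_of_succ_le hj))
      (r.trial j (Nat.le_of_succ_le hj)).1 (r.damping_mem_Icc j)

theorem x_mem (h : Convex ℝ (domF D g)) : ∀ k ≤ r.K, r.x k ∈ domF D g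
  | 0, _ => r.x_zero ▸ r.z_mem h r.J le_rfl
  | k + 1, hk => (r.x_succ k hk).1

end PathFollowingRun

end Run

section CentralPath

variable {E : Type*} [NormedAddCommGroup E] [NormedSpace ℝ E]
  {D : Set E} {f : E → ℝ} {g : E → EReal} {ν t δ : ℝ} {x y z c : E}

/-- `x` minimizes the penalized objective `F(·; t) = f + t⁻¹ g` over `dom F`: this is
`IsPenalizedSolution` on any normed space. -/
def IsPenalizedMin (D : Set E) (f : E → ℝ) (g : E → EReal) (t : ℝ) (x : E) : Prop :=
  x ∈ D ∩ {y | g y < ⊤} ∧ IsMinOn (fun y => f y + t⁻¹ * (g y).toReal) (D ∩ {y | g y < ⊤}) x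

/-- `y` is a `δ`-solution of the subproblem with model `F̂(·; t, c)`: this is `IsInexactSolution`
on any normed space. -/
def IsModelSolution (D : Set E) (f : E → ℝ) (g : E → EReal) (t δ : ℝ) (c y : E) : Prop :=
  y ∈ D ∩ {x | g x < ⊤} ∧ ∀ z ∈ D ∩ {x | g x < ⊤},
    taylorTwo f c y + t⁻¹ * (g y).toReal - (taylorTwo f c z + t⁻¹ * (g z).toReal) ≤ δ ^ 2 / 2

theorem IsPenalizedMin.toReal_sub_le (hx : IsPenalizedMin D f g t x) (hf : IsBarrierOn D f ν)
    (hbot : ∀ x, g x ≠ ⊥) (hepi : Convex ℝ {p : E × ℝ | g p.1 ≤ (p.2 : EReal)}) (ht : 0 < t)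
    (hz : z ∈ closure D) (hgz : g z < ⊤) : (g x).toReal - (g z).toReal ≤ t * ν :=
  (sub_le_mul_fderiv_of_isMinOn hf.isOpen hf.convex (convexOn_toReal hbot hepi)
    (hf.differentiableAt hx.1.1) ht hx.1 hx.2 ⟨hz, hgz⟩).trans
    (mul_le_mul_of_nonneg_left (hf.fderiv_sub_le hx.1.1 hz) ht.le)

theorem IsModelSolution.toReal_sub_le (hy : IsModelSolution D f g t δ c y)
    (hf : IsBarrierOn D f ν) (ht : 0 < t) (hδ : 0 ≤ δ) (hc : c ∈ D)
    (hx : x ∈ D ∩ {y | g y < ⊤}) (hlt : hessNorm f x (c - x) < 1) :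
    (g y).toReal - (g x).toReal ≤
      t * gapBound ν (hessNorm f x (c - x)) (hessNorm f x (y - x)) δ := by
  have hmodel : t⁻¹ * ((g y).toReal - (g x).toReal) ≤
      taylorTwo f c x - taylorTwo f c y + δ ^ 2 / 2 := by
    linarith [hy.2 x hx]
  have hgap : taylorTwo f c x - taylorTwo f c y + δ ^ 2 / 2 ≤
      gapBound ν (hessNorm f x (c - x)) (hessNorm f x (y - x)) δ := by
    have hl := hessNorm_nonneg f x (c - x)
    refine add_le_add_left ((hf.taylorTwo_sub_le hx.1 hc hlt y).trans ?_) _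
    gcongr
    linarith
  exact (inv_mul_le_iff₀ ht).1 (hmodel.trans hgap)

theorem psi_eq_add_gapBound (ν l m δ : ℝ) : psi ν l m δ = ν + gapBound ν l m δ := by
  rw [psi, gapBound]
  ring

end CentralPath

end ProxPath

open ProxPath in
theorem lemma5p1_general {E : Type*} [NormedAddCommGroup E] [NormedSpace ℝ E] {D : Set E}
    {f : E → ℝ} {g : E → EReal} {ν : ℝ} {xopt : E} (hf : IsBarrierOn D f ν)
    (hbot : ∀ x, g x ≠ ⊥) (hepi : Convex ℝ {p : E × ℝ | g p.1 ≤ (p.2 : EReal)})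
    (hxopt : xopt ∈ closure D) (hmin : IsMinOn g (closure D) xopt) :
    (∀ t : ℝ, 0 < t → ∀ xt, IsPenalizedMin D f g t xt →
      xt ∈ interior (closure D) ∧ 0 ≤ g xt - g xopt ∧ g xt - g xopt ≤ ((t * ν : ℝ) : EReal)) ∧
    (∀ y ∈ D ∩ {x | g x < ⊤}, 0 ≤ g y - g xopt ∧
      ∀ t : ℝ, 0 < t → ∀ xt, IsPenalizedMin D f g t xt →
        ((-(ν * t) : ℝ) : EReal) ≤ g y - g xt) ∧
    (∀ t δ : ℝ, 0 < t → 0 ≤ δ → ∀ c ∈ D, ∀ y, IsModelSolution D f g t δ c y →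
      ∀ xt, IsPenalizedMin D f g t xt → hessNorm f xt (c - xt) < 1 →
        g y - g xt ≤
          ((t * gapBound ν (hessNorm f xt (c - xt)) (hessNorm f xt (y - xt)) δ : ℝ) : EReal) ∧
        g y - g xopt ≤
          ((t * psi ν (hessNorm f xt (c - xt)) (hessNorm f xt (y - xt)) δ : ℝ) : EReal)) := by
  have hfin : ∀ {y}, y ∈ D ∩ {x | g x < ⊤} → g xopt < ⊤ := fun hy =>
    (hmin (subset_closure hy.1)).trans_lt hy.2
  have hnonneg : ∀ y ∈ D ∩ {x | g x < ⊤}, 0 ≤ g y - g xopt := fun y hy => by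
    rw [sub_eq_coe_toReal_sub hbot hy.2 (hfin hy)]
    exact_mod_cast sub_nonneg.2 (toReal_le_of_isMinOn (hbot xopt) hmin (subset_closure hy.1) hy.2)
  refine ⟨fun t ht xt hxt => ⟨interior_maximal subset_closure hf.isOpen hxt.1.1,
    hnonneg xt hxt.1, ?_⟩, fun y hy => ⟨hnonneg y hy, fun t ht xt hxt => ?_⟩,
    fun t δ ht hδ c hc y hy xt hxt hlt => ?_⟩
  · rw [sub_eq_coe_toReal_sub hbot hxt.1.2 (hfin hxt.1), EReal.coe_le_coe_iff]
    exact hxt.toReal_sub_le hf hbot hepi ht hxopt (hfin hxt.1)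
  · rw [sub_eq_coe_toReal_sub hbot hy.2 hxt.1.2, EReal.coe_le_coe_iff]
    linarith [hxt.toReal_sub_le hf hbot hepi ht (subset_closure hy.1) hy.2]
  · have hgap := hy.toReal_sub_le hf ht hδ hc hxt.1 hlt
    rw [sub_eq_coe_toReal_sub hbot hy.1.2 hxt.1.2, sub_eq_coe_toReal_sub hbot hy.1.2 (hfin hy.1),
      EReal.coe_le_coe_iff, EReal.coe_le_coe_iff, psi_eq_add_gapBound, mul_add]
    exact ⟨hgap, by linarith [hxt.toReal_sub_le hf hbot hepi ht hxopt (hfin hy.1)]⟩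

theorem lemma5p1 {n : ℕ} (Ω D : Set (EuclideanSpace ℝ (Fin n)))
    (f : EuclideanSpace ℝ (Fin n) → ℝ) (g : EuclideanSpace ℝ (Fin n) → EReal) (ν : ℝ)
    (hf : ProxPath.IsSelfConcordantBarrier D f ν) (hΩ : closure D = Ω)
    (hg : ProxPath.IsProperLscConvex g)
    (xopt : EuclideanSpace ℝ (Fin n)) (hxopt : ProxPath.IsConstrainedSolution Ω g xopt) :
    (∀ t : ℝ, 0 < t → ∀ xt : EuclideanSpace ℝ (Fin n), ProxPath.IsPenalizedSolution D f g t xt →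
      xt ∈ interior Ω ∧ 0 ≤ g xt - g xopt ∧ g xt - g xopt ≤ ((t * ν : ℝ) : EReal)) ∧
    (∀ r : ProxPath.PathFollowingRun D f g ν,
      (∀ k ≤ r.K,
        0 ≤ g (r.x k) - g xopt ∧
        ∀ xt : EuclideanSpace ℝ (Fin n), ProxPath.IsPenalizedSolution D f g (r.t k) xt →
          ((-(ν * r.t k) : ℝ) : EReal) ≤ g (r.x k) - g xt) ∧
      (∀ k < r.K, ∀ xt : EuclideanSpace ℝ (Fin n),
        ProxPath.IsPenalizedSolution D f g (r.t (k + 1)) xt →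
        ∀ lam lamPlus : ℝ,
          lam = ProxPath.localNorm f xt (r.x k - xt) →
          lamPlus = ProxPath.localNorm f xt (r.x (k + 1) - xt) →
          lam < 1 →
          g (r.x (k + 1)) - g xt
              ≤ ((r.t (k + 1) * ProxPath.gapBound ν lam lamPlus (r.δ (k + 1)) : ℝ) : EReal) ∧
          g (r.x (k + 1)) - g xopt
              ≤ ((r.t (k + 1) * ProxPath.psi ν lam lamPlus (r.δ (k + 1)) : ℝ) : EReal))) := by
  subst hΩ
  obtain ⟨hpath, hmem, hstep⟩ :=
    lemma5p1_general hf.isBarrierOn hg.ne_bot hg.convex_epigraph hxopt.1 hxopt.2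
  refine ⟨hpath, fun r => ?_⟩
  have hx := r.x_mem (hf.selfConcordant.convexOn.1.inter
    (ProxPath.convexOn_toReal hg.ne_bot hg.convex_epigraph).1)
  refine ⟨fun k hk => ⟨(hmem _ (hx k hk)).1, (hmem _ (hx k hk)).2 _ (r.t_pos k hk)⟩, ?_⟩
  rintro k hk xt hxt _ _ rfl rfl hlt
  exact hstep _ _ (r.t_pos _ hk) (r.δ_nonneg k hk) _ (hx k hk.le).1 _ (r.x_succ k hk) _ hxt hlt
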